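/- A real-valued measurable function $f$ on $[0,\infty)$ is called regularly varying (at infinity) of index $\beta\in\mathbb R$ if $f(tx)/f(x)\to t^{\beta}$ as $x\to\infty$ for every $t>0$. Write $f(y)\sim g(y)$ as $y\to\infty$ if $f(y)/g(y)\to 1$ as $y\to\infty$. Let $\rho$ be a finite positive Borel measure on $[0,\infty)$ and fix $\alpha\in[0,2)$. Then the following statements are equivalent: (i) $y\mapsto \rho(y,\infty)$ is regularly varying of index $-\alpha$; (ii) $y\mapsto\int_0^{\infty}\frac{t^2}{t^2+y^2}\,d\rho(t)$ is regularly varying of index $-\alpha$. If either of these conditions is satisfied, then $$\int_0^{\infty}\frac{t^2}{t^2+y^2}\,d\rho(t)\sim \frac{\frac{\pi\alpha}{2}}{\sin\frac{\pi\alpha}{2}}\,\rho(y,\infty)\quad\text{as } y\to\infty,$$ where the constant factor on the right-hand side is interpreted as $1$ when $\alpha=0$. -/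

import Mathlib

open Filter Topology MeasureTheory Asymptotics

/-- A measurable real valued function on `[0, ∞)` is regularly varying (at infinity) with index `β`
if `f (t x) / f x → t ^ β` as `x → ∞`, for every `t > 0`. Only the values of `f` on `[0, ∞)` matter.
(The case `t = 1` forces `f x ≠ 0` for all large `x`, so the quotients are genuine.) -/
def IsRegularlyVarying (f : ℝ → ℝ) (β : ℝ) : Prop :=
  Measurable (fun x : Set.Ici (0 : ℝ) => f x) ∧
    ∀ t : ℝ, 0 < t → Tendsto (fun x : ℝ => f (t * x) / f x) atTop (𝓝 (t ^ β))

/-- The constant `(πα/2) / sin (πα/2)`, interpreted as `1` when `α = 0`. -/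
noncomputable def stieltjesConst (α : ℝ) : ℝ :=
  if α = 0 then 1 else (Real.pi * α / 2) / Real.sin (Real.pi * α / 2)

/-! Write F(y) = ρ(y,∞) and G(y) for the transform. By the layer-cake formula, G(y) = ∫₀^∞ k(u)
F(uy) du with k(u) = 2u/(1+u²)². If F is regularly varying, divide by F(y) and use dominated
convergence with a Potter bound: G/F → ∫ k(u) u^(-α) du, a Beta integral equal to the stated
constant c.

The converse is Karamata's method. With p = y²/(t²+y²), regular variation of G says that the means
of 1/(1-zp) against t²/(t²+y²) dρ, normalized, converge for 0 < z < 1. Hence so do those of all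
powers of p, and by Weierstrass those of every continuous function. A continuous ramp traps its mean
between F(qy)/G(y) and F(y)/G(y); letting q → 1 shows that F/G has some limit l. The dominated
convergence argument, now with denominator G, gives 1 = G/G → l·c, so l = 1/c. -/

theorem exists_tendsto_of_forall_eventually_abs_sub_le {h : ℝ → ℝ}
    (H : ∀ ε > 0, ∃ L, ∀ᶠ y in atTop, |h y - L| ≤ ε) : ∃ L, Tendsto h atTop (𝓝 L) := by
  apply cauchy_map_iff_exists_tendsto.1
  rw [Metric.cauchy_iff]
  refine ⟨inferInstance, fun ε hε => ?_⟩
  obtain ⟨L, hL⟩ := H (ε / 3) (by positivity)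
  refine ⟨Metric.closedBall L (ε / 3), ?_, fun x hx y hy => ?_⟩
  · refine mem_map.2 ?_
    filter_upwards [hL] with y hy
    simpa [Real.dist_eq] using hy
  · have := dist_triangle_right x y L
    rw [Metric.mem_closedBall] at hx hy
    linarith

/-! ### The kernel and its power moments -/

theorem integral_beta_kernel {a b : ℝ} (ha : 0 < a) (hb : 0 < b) :
    ∫ x in Set.Ioo (0 : ℝ) 1, x ^ (a - 1) * (1 - x) ^ (b - 1) = ProbabilityTheory.beta a b := by
  have h := ProbabilityTheory.lintegral_betaPDF_eq_one ha hb
  have hpos := ProbabilityTheory.beta_pos ha hb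
  rw [ProbabilityTheory.lintegral_betaPDF, ← ENNReal.toReal_eq_one_iff,
    ← integral_eq_lintegral_of_nonneg_ae] at h
  · simp_rw [mul_assoc, integral_const_mul] at h
    field_simp at h
    exact h
  · refine (ae_restrict_iff' measurableSet_Ioo).2 (ae_of_all _ fun x hx => ?_)
    have := hx.1
    have : 0 < 1 - x := by linarith [hx.2]
    simp only [Pi.zero_apply]
    positivity
  · exact Measurable.aestronglyMeasurable (by fun_prop)

/-- The density of the distribution function `u ↦ u ^ 2 / (1 + u ^ 2)`. -/
noncomputable def stieltjesKernel (u : ℝ) : ℝ := 2 * u / (1 + u ^ 2) ^ 2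

theorem continuous_stieltjesKernel : Continuous stieltjesKernel := by
  unfold stieltjesKernel
  exact Continuous.div (by fun_prop) (by fun_prop) fun u => by positivity

theorem stieltjesKernel_nonneg {u : ℝ} (hu : 0 ≤ u) : 0 ≤ stieltjesKernel u := by
  unfold stieltjesKernel
  positivity

theorem hasDerivAt_sq_div_one_add_sq (u : ℝ) :
    HasDerivAt (fun u : ℝ => u ^ 2 / (1 + u ^ 2)) (stieltjesKernel u) u := by
  have h1 : HasDerivAt (fun u : ℝ => u ^ 2) (2 * u) u := by simpa using hasDerivAt_pow 2 u
  have h := h1.div (h1.const_add 1) (by positivity)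
  refine h.congr_deriv ?_
  unfold stieltjesKernel
  congr 1
  ring

theorem integral_stieltjesKernel (x : ℝ) :
    ∫ u in (0 : ℝ)..x, stieltjesKernel u = x ^ 2 / (1 + x ^ 2) := by
  rw [intervalIntegral.integral_eq_sub_of_hasDerivAt
    (fun u _ => hasDerivAt_sq_div_one_add_sq u)
    (continuous_stieltjesKernel.intervalIntegrable _ _)]
  simp

theorem image_sq_div_one_add_sq :
    (fun u : ℝ => u ^ 2 / (1 + u ^ 2)) '' Set.Ioi 0 = Set.Ioo 0 1 := by
  ext x
  constructor
  · rintro ⟨u, hu, rfl⟩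
    have hu : 0 < u := hu
    refine ⟨by positivity, ?_⟩
    rw [div_lt_one (by positivity)]
    linarith
  · rintro ⟨h0, h1⟩
    have h1' : 0 < 1 - x := by linarith
    refine ⟨√(x / (1 - x)), Real.sqrt_pos.2 (by positivity), ?_⟩
    simp only
    rw [Real.sq_sqrt (by positivity)]
    field_simp
    ring

theorem injOn_sq_div_one_add_sq :
    Set.InjOn (fun u : ℝ => u ^ 2 / (1 + u ^ 2)) (Set.Ioi 0) := by
  intro u hu v hv h
  have hu : 0 < u := hu
  have hv : 0 < v := hv
  simp only at h
  rw [div_eq_div_iff (by positivity) (by positivity)] at h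
  have : u ^ 2 = v ^ 2 := by linarith
  exact (pow_left_inj₀ hu.le hv.le two_ne_zero).1 this

/-- Substitute x = u²/(1+u²), so that 1 - x = 1/(1+u²) and u² = x/(1-x). -/
theorem integral_stieltjesKernel_mul_rpow_eq_beta {α : ℝ} (h0 : -2 < α) (h2 : α < 2) :
    ∫ u in Set.Ioi (0 : ℝ), stieltjesKernel u * u ^ (-α)
      = ProbabilityTheory.beta (1 - α / 2) (1 + α / 2) := by
  rw [← integral_beta_kernel (by linarith) (by linarith), ← image_sq_div_one_add_sq,
    integral_image_eq_integral_abs_deriv_smul measurableSet_Ioi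
      (fun u _ => (hasDerivAt_sq_div_one_add_sq u).hasDerivWithinAt) injOn_sq_div_one_add_sq]
  refine setIntegral_congr_fun measurableSet_Ioi fun u hu => ?_
  have hu : 0 < u := hu
  simp only [smul_eq_mul]
  rw [abs_of_nonneg (stieltjesKernel_nonneg hu.le)]
  congr 1
  have e : 1 - u ^ 2 / (1 + u ^ 2) = 1 / (1 + u ^ 2) := by field_simp; ring
  rw [e, Real.div_rpow (by positivity) (by positivity), Real.div_rpow (by positivity)
    (by positivity), show (1 - α / 2 - 1 : ℝ) = -(α / 2) by ring,
    show (1 + α / 2 - 1 : ℝ) = α / 2 by ring, Real.rpow_neg (by positivity),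
    Real.rpow_neg (by positivity), Real.rpow_neg (by positivity), Real.one_rpow,
    ← Real.rpow_natCast u 2, ← Real.rpow_mul hu.le]
  have : (0 : ℝ) < (1 + u ^ ((2 : ℕ) : ℝ)) ^ (α / 2) := by positivity
  field_simp
  congr 1
  push_cast
  ring

theorem integrableOn_stieltjesKernel_mul_rpow {α : ℝ} (h0 : -2 < α) (h2 : α < 2) :
    IntegrableOn (fun u => stieltjesKernel u * u ^ (-α)) (Set.Ioi 0) := by
  -- A non-integrable function has integral 0 by convention, but the Beta value is positive.
  by_contra h
  have := integral_stieltjesKernel_mul_rpow_eq_beta h0 h2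
  rw [integral_undef h] at this
  have hp : 0 < ProbabilityTheory.beta (1 - α / 2) (1 + α / 2) :=
    ProbabilityTheory.beta_pos (by linarith) (by linarith)
  linarith

theorem integral_stieltjesKernel_mul_rpow {α : ℝ} (h0 : 0 ≤ α) (h2 : α < 2) :
    ∫ u in Set.Ioi (0 : ℝ), stieltjesKernel u * u ^ (-α) = stieltjesConst α := by
  rw [integral_stieltjesKernel_mul_rpow_eq_beta (by linarith) h2, stieltjesConst,
    ProbabilityTheory.beta]
  split_ifs with h
  · simp [h, one_add_one_eq_two]
  · rw [add_comm 1 (α / 2), Real.Gamma_add_one (by positivity),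
      show 1 - α / 2 + (α / 2 + 1) = 2 by ring, Real.Gamma_two,
      show Real.pi * α / 2 = Real.pi * (α / 2) by ring]
    have h := Real.Gamma_mul_Gamma_one_sub (α / 2)
    linear_combination α / 2 * h

theorem stieltjesConst_pos {α : ℝ} (h0 : 0 ≤ α) (h2 : α < 2) : 0 < stieltjesConst α := by
  rw [← integral_stieltjesKernel_mul_rpow h0 h2,
    integral_stieltjesKernel_mul_rpow_eq_beta (by linarith) h2]
  exact ProbabilityTheory.beta_pos (by linarith) (by linarith)

/-! ### Potter bound and dominated convergence -/

/-- A Potter type bound for monotone functions. -/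
theorem exists_forall_le_mul_rpow_neg {H : ℝ → ℝ} {α γ : ℝ} (hanti : AntitoneOn H (Set.Ici 0))
    (hnn : ∀ x, 0 ≤ H x) (hγ0 : 0 ≤ γ) (hγ : α < γ)
    (hpos : ∀ᶠ x in atTop, 0 < H x)
    (h2 : Tendsto (fun x => H (2 * x) / H x) atTop (𝓝 (2 ^ (-α)))) :
    ∃ C, 0 ≤ C ∧ ∀ᶠ x in atTop, ∀ u, 0 < u → u ≤ 1 → H (u * x) ≤ C * u ^ (-γ) * H x := by
  have hlt : (2 : ℝ) ^ (-γ) < 2 ^ (-α) := Real.rpow_lt_rpow_of_exponent_lt (by norm_num) (by linarith)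
  obtain ⟨x₀, hx₀⟩ := eventually_atTop.1 ((h2.eventually_const_lt hlt).and hpos)
  set y₀ := max x₀ 1
  have hy0 : 0 < y₀ := lt_max_of_lt_right one_pos
  have hHpos : ∀ x, y₀ ≤ x → 0 < H x := fun x hx => (hx₀ x ((le_max_left _ _).trans hx)).2
  have step : ∀ x, y₀ ≤ x → H x ≤ 2 ^ γ * H (2 * x) := fun x hx => by
    have h := (hx₀ x ((le_max_left _ _).trans hx)).1
    rw [lt_div_iff₀ (hHpos x hx), Real.rpow_neg (by norm_num)] at h
    have h2 : (0 : ℝ) < 2 ^ γ := by positivity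
    rw [inv_mul_lt_iff₀ h2] at h
    exact h.le
  have iter : ∀ (n : ℕ) x, y₀ ≤ x → H x ≤ (2 ^ n : ℝ) ^ γ * H (2 ^ n * x) := by
    intro n
    induction n with
    | zero => intro x _; simp
    | succ n ih =>
      intro x hx
      have hx' : y₀ ≤ 2 ^ n * x := by
        nlinarith [one_le_pow₀ (one_le_two : (1 : ℝ) ≤ 2) (n := n)]
      calc H x ≤ (2 ^ n : ℝ) ^ γ * H (2 ^ n * x) := ih x hx
        _ ≤ (2 ^ n : ℝ) ^ γ * (2 ^ γ * H (2 * (2 ^ n * x))) := by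
          gcongr; exact step _ hx'
        _ = _ := by
          rw [pow_succ, Real.mul_rpow (by positivity) (by positivity)]
          ring_nf
  have large : ∀ y x, y₀ ≤ y → y ≤ x → H y ≤ 2 ^ γ * (x / y) ^ γ * H x := by
    intro y x hy hyx
    have hypos : 0 < y := hy0.trans_le hy
    obtain ⟨n, hn1, hn2⟩ := exists_nat_pow_near ((one_le_div hypos).2 hyx) (one_lt_two (α := ℝ))
    calc H y ≤ (2 ^ (n + 1) : ℝ) ^ γ * H (2 ^ (n + 1) * y) := iter _ _ hy
      _ ≤ (2 * (x / y)) ^ γ * H x := by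
        have : 0 ≤ x / y := by have := hypos.trans_le hyx; positivity
        gcongr
        · exact hnn _
        · rw [pow_succ]; linarith
        · rw [div_lt_iff₀ hypos] at hn2
          exact hanti (Set.mem_Ici.2 (by linarith)) (Set.mem_Ici.2 (by positivity)) hn2.le
      _ = _ := by rw [Real.mul_rpow (by norm_num) (by have := hypos.trans_le hyx; positivity)]
  have h00 : H y₀ ≤ H 0 := hanti (Set.mem_Ici.2 le_rfl) hy0.le hy0.le
  have hM := hHpos y₀ le_rfl
  -- 2^γ pays for rounding x/y up to a power of 2; `H 0 / H y₀` ≥ 1 covers u * x < y₀, where only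
  -- monotonicity is available.
  refine ⟨H 0 / H y₀ * 2 ^ γ, by have := hnn 0; positivity, ?_⟩
  filter_upwards [eventually_ge_atTop y₀] with x hx u hu hu1
  have hxpos : 0 < x := hy0.trans_le hx
  have hHx := hHpos x hx
  have e : u ^ (-γ) = (x / (u * x)) ^ γ := by
    rw [Real.rpow_neg hu.le, ← Real.inv_rpow hu.le]
    congr 1
    field_simp
  rw [e]
  rcases le_total y₀ (u * x) with h | h
  · calc H (u * x) ≤ 1 * (2 ^ γ * (x / (u * x)) ^ γ * H x) := by
          rw [one_mul]; exact large _ _ h (by nlinarith)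
      _ ≤ H 0 / H y₀ * (2 ^ γ * (x / (u * x)) ^ γ * H x) := by
          gcongr
          exact (one_le_div hM).2 h00
      _ = _ := by ring
  · calc H (u * x) ≤ H 0 := hanti (Set.mem_Ici.2 le_rfl) (Set.mem_Ici.2 (by positivity)) (by positivity)
      _ = H 0 / H y₀ * H y₀ := by field_simp
      _ ≤ H 0 / H y₀ * (2 ^ γ * (x / y₀) ^ γ * H x) := by
          have := hnn 0
          gcongr
          exact large _ _ le_rfl hx
      _ ≤ H 0 / H y₀ * (2 ^ γ * (x / (u * x)) ^ γ * H x) := by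
          have := hnn 0
          gcongr
      _ = _ := by ring

/-- Separate F and H let this serve both directions: F = H is the tail in the Abelian one; F is the
tail and H the transform in the Tauberian one. -/
theorem tendsto_integral_stieltjesKernel_mul_div {F H : ℝ → ℝ} {α l C₀ : ℝ} (h0 : 0 ≤ α)
    (h2 : α < 2) (hFm : Measurable F) (hF : ∀ x, 0 ≤ F x) (hFH : ∀ x, 0 < x → F x ≤ C₀ * H x)
    (hanti : AntitoneOn H (Set.Ici 0)) (hnn : ∀ x, 0 ≤ H x) (hpos : ∀ᶠ x in atTop, 0 < H x)
    (hreg : ∀ t : ℝ, 0 < t → Tendsto (fun x => H (t * x) / H x) atTop (𝓝 (t ^ (-α))))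
    (hl : Tendsto (fun x => F x / H x) atTop (𝓝 l)) :
    Tendsto (fun x => (∫ u in Set.Ioi (0 : ℝ), stieltjesKernel u * F (u * x)) / H x) atTop
      (𝓝 (l * stieltjesConst α)) := by
  have hC₀ : 0 ≤ C₀ := by
    obtain ⟨x, hx, hx'⟩ := (hpos.and (eventually_gt_atTop 0)).exists
    have := (hF x).trans (hFH x hx')
    exact nonneg_of_mul_nonneg_left this hx
  -- The exponent exceeds α for Potter and stays below 2, so that k(u) u^(-γ) is integrable at 0.
  obtain ⟨C, hC, hb⟩ := exists_forall_le_mul_rpow_neg (γ := (α + 2) / 2) hanti hnn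
    (by linarith) (by linarith) hpos (hreg 2 two_pos)
  have hlim : l * stieltjesConst α
      = ∫ u in Set.Ioi (0 : ℝ), stieltjesKernel u * (l * u ^ (-α)) := by
    rw [← integral_stieltjesKernel_mul_rpow h0 h2, ← integral_const_mul]
    congr with u
    ring
  have hfun : (fun x => (∫ u in Set.Ioi (0 : ℝ), stieltjesKernel u * F (u * x)) / H x)
      = fun x => ∫ u in Set.Ioi (0 : ℝ), stieltjesKernel u * (F (u * x) / H x) := by
    ext x
    rw [← integral_div]
    congr with u
    ring
  rw [hlim, hfun]
  refine tendsto_integral_filter_of_dominated_convergence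
    (fun u => C₀ * (stieltjesKernel u * u ^ (-(0 : ℝ)))
      + C₀ * C * (stieltjesKernel u * u ^ (-((α + 2) / 2)))) ?_ ?_ ?_ ?_
  · refine Eventually.of_forall fun x => Measurable.aestronglyMeasurable ?_
    exact continuous_stieltjesKernel.measurable.mul
      ((hFm.comp (measurable_id.mul_const x)).div_const _)
  · filter_upwards [hb, hpos, eventually_gt_atTop 0] with x hbx hx hx0
    refine (ae_restrict_iff' measurableSet_Ioi).2 (ae_of_all _ fun u hu => ?_)
    have hu : 0 < u := hu
    have hk := stieltjesKernel_nonneg hu.le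
    rw [Real.norm_eq_abs, abs_of_nonneg (mul_nonneg hk (div_nonneg (hF _) hx.le))]
    have key : F (u * x) / H x ≤ C₀ * (1 + C * u ^ (-((α + 2) / 2))) := by
      rw [div_le_iff₀ hx, mul_assoc]
      refine (hFH _ (by positivity)).trans ?_
      gcongr
      have : 0 ≤ C * u ^ (-((α + 2) / 2)) * H x := by positivity
      rcases le_total u 1 with h | h
      · have := hbx u hu h
        linarith
      · have := hanti (Set.mem_Ici.2 hx0.le) (Set.mem_Ici.2 (by positivity))
          (by nlinarith : x ≤ u * x)
        linarith
    calc _ ≤ stieltjesKernel u * (C₀ * (1 + C * u ^ (-((α + 2) / 2)))) := by gcongr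
      _ = _ := by rw [neg_zero, Real.rpow_zero]; ring
  · exact ((integrableOn_stieltjesKernel_mul_rpow (by norm_num) (by norm_num)).const_mul _).add
      ((integrableOn_stieltjesKernel_mul_rpow (by linarith) (by linarith)).const_mul _)
  · refine (ae_restrict_iff' measurableSet_Ioi).2 (ae_of_all _ fun u hu => ?_)
    have hu : 0 < u := hu
    refine Tendsto.const_mul _ ?_
    have h1 : Tendsto (fun x => F (u * x) / H (u * x)) atTop (𝓝 l) :=
      hl.comp (tendsto_id.const_mul_atTop hu)
    refine (h1.mul (hreg u hu)).congr' ?_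
    filter_upwards [(tendsto_id.const_mul_atTop hu).eventually hpos] with x hx
    have hx : 0 < H (u * x) := hx
    field_simp

/-! ### The transform and the tail -/

theorem sq_div_sq_add_sq_nonneg (t y : ℝ) : 0 ≤ t ^ 2 / (t ^ 2 + y ^ 2) := by positivity

theorem sq_div_sq_add_sq_le_one (t y : ℝ) : t ^ 2 / (t ^ 2 + y ^ 2) ≤ 1 :=
  div_le_one_of_le₀ (by nlinarith [sq_nonneg y]) (by positivity)

section
variable (ρ : Measure ℝ) [IsFiniteMeasure ρ]

theorem integrable_sq_div_sq_add_sq (y : ℝ) :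
    Integrable (fun t => t ^ 2 / (t ^ 2 + y ^ 2)) ρ := by
  refine Integrable.of_bound (Measurable.aestronglyMeasurable (by fun_prop)) 1
    (ae_of_all _ fun t => ?_)
  rw [Real.norm_eq_abs, abs_of_nonneg (sq_div_sq_add_sq_nonneg t y)]
  exact sq_div_sq_add_sq_le_one t y

theorem antitone_measureReal_Ioi : Antitone fun y : ℝ => ρ.real (Set.Ioi y) :=
  fun _ _ h => measureReal_mono (Set.Ioi_subset_Ioi h)

theorem antitoneOn_integral_sq_div_sq_add_sq :
    AntitoneOn (fun y : ℝ => ∫ t, t ^ 2 / (t ^ 2 + y ^ 2) ∂ρ) (Set.Ici 0) := by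
  intro x hx y hy hxy
  refine integral_mono (integrable_sq_div_sq_add_sq ρ y) (integrable_sq_div_sq_add_sq ρ x)
    fun t => ?_
  rcases eq_or_ne t 0 with rfl | ht
  · simp
  · have hx : 0 ≤ x := hx
    have : 0 < t ^ 2 := by positivity
    simp only
    gcongr

/-- The integrand is at least 1/2 where t > y. -/
theorem measureReal_Ioi_le_two_mul_integral {y : ℝ} (hy : 0 < y) :
    ρ.real (Set.Ioi y) ≤ 2 * ∫ t, t ^ 2 / (t ^ 2 + y ^ 2) ∂ρ := by
  rw [← integral_const_mul, ← integral_indicator_one measurableSet_Ioi]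
  refine integral_mono ((integrable_const 1).indicator measurableSet_Ioi)
    ((integrable_sq_div_sq_add_sq ρ y).const_mul 2) fun t => ?_
  by_cases ht : t ∈ Set.Ioi y
  · have ht' : y < t := ht
    have : 0 < t := hy.trans ht'
    simp only [Set.indicator_of_mem ht, Pi.one_apply]
    rw [← mul_div_assoc, le_div_iff₀ (by positivity)]
    nlinarith
  · simp only [Set.indicator_of_notMem ht]
    positivity

variable {ρ}

theorem integral_sq_div_sq_add_sq_eq_integral_measureReal_Ioi (hρ : ∀ᵐ t ∂ρ, 0 ≤ t) {y : ℝ}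
    (hy : 0 < y) :
    ∫ t, t ^ 2 / (t ^ 2 + y ^ 2) ∂ρ
      = ∫ u in Set.Ioi (0 : ℝ), stieltjesKernel u * ρ.real (Set.Ioi (u * y)) := by
  have key := lintegral_comp_eq_lintegral_meas_lt_mul ρ (f := fun t => t / y)
    (g := stieltjesKernel) (hρ.mono fun t ht => div_nonneg ht hy.le) (by fun_prop)
    (fun t _ => continuous_stieltjesKernel.intervalIntegrable _ _)
    ((ae_restrict_iff' measurableSet_Ioi).2 (ae_of_all _ fun u hu =>
      stieltjesKernel_nonneg (le_of_lt hu)))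
  have e (t : ℝ) : (t / y) ^ 2 / (1 + (t / y) ^ 2) = t ^ 2 / (t ^ 2 + y ^ 2) := by
    field_simp
    ring
  simp_rw [integral_stieltjesKernel, e] at key
  rw [integral_eq_lintegral_of_nonneg_ae (ae_of_all _ fun t => sq_div_sq_add_sq_nonneg t y)
    (Measurable.aestronglyMeasurable (by fun_prop)), key,
    integral_eq_lintegral_of_nonneg_ae]
  · congr 1
    refine setLIntegral_congr_fun measurableSet_Ioi fun u hu => ?_
    rw [ENNReal.ofReal_mul (stieltjesKernel_nonneg (le_of_lt hu)), ofReal_measureReal, mul_comm]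
    congr 2
    ext t
    simp [lt_div_iff₀ hy]
  · exact (ae_restrict_iff' measurableSet_Ioi).2 (ae_of_all _ fun u hu =>
      mul_nonneg (stieltjesKernel_nonneg (le_of_lt hu)) measureReal_nonneg)
  · exact (continuous_stieltjesKernel.measurable.mul
      ((antitone_measureReal_Ioi ρ).measurable.comp
        (measurable_id.mul_const y))).aestronglyMeasurable

end

theorem eventually_pos_of_tendsto_self_div {H : ℝ → ℝ} {α : ℝ} (hnn : ∀ x, 0 ≤ H x)
    (h : ∀ t : ℝ, 0 < t → Tendsto (fun x => H (t * x) / H x) atTop (𝓝 (t ^ α))) :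
    ∀ᶠ x in atTop, 0 < H x := by
  -- At t = 1 the quotient is `H x / H x`, which is 0 by convention when `H x = 0`.
  have h1 := h 1 one_pos
  rw [Real.one_rpow] at h1
  filter_upwards [h1.eventually_const_lt one_half_lt_one] with x hx
  refine (hnn x).lt_of_ne fun h => ?_
  rw [← h] at hx
  norm_num at hx

/-- Regular variation passes to asymptotically proportional functions. -/
theorem tendsto_div_rpow_of_tendsto_div {F H : ℝ → ℝ} {β l : ℝ} (hl0 : l ≠ 0)
    (hH : ∀ᶠ x in atTop, 0 < H x)
    (h : ∀ t : ℝ, 0 < t → Tendsto (fun x => H (t * x) / H x) atTop (𝓝 (t ^ β)))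
    (hl : Tendsto (fun x => F x / H x) atTop (𝓝 l)) (t : ℝ) (ht : 0 < t) :
    Tendsto (fun x => F (t * x) / F x) atTop (𝓝 (t ^ β)) := by
  have hm : Tendsto (fun x : ℝ => t * x) atTop atTop := tendsto_id.const_mul_atTop ht
  have := ((hl.comp hm).mul (h t ht)).div hl hl0
  rw [mul_div_cancel_left₀ _ hl0] at this
  refine this.congr' ?_
  filter_upwards [hH, hm.eventually hH] with x h1 h2
  simp only [Function.comp, Pi.div_apply]
  field_simp

/-! ### Karamata's method -/

/-- The mean of `φ (y ^ 2 / (t ^ 2 + y ^ 2))` over `t` with respect to the normalization of the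
measure `t ^ 2 / (t ^ 2 + y ^ 2) dρ(t)`. -/
noncomputable def scaledMean (ρ : Measure ℝ) (φ : ℝ → ℝ) (y : ℝ) : ℝ :=
  (∫ t, φ (y ^ 2 / (t ^ 2 + y ^ 2)) * (t ^ 2 / (t ^ 2 + y ^ 2)) ∂ρ) /
    ∫ t, t ^ 2 / (t ^ 2 + y ^ 2) ∂ρ

/-- The scaled means of the continuous function `φ` converge at infinity. -/
def HasScaledMeanLimit (ρ : Measure ℝ) (φ : ℝ → ℝ) : Prop :=
  ContinuousOn φ (Set.Icc 0 1) ∧ ∃ L, Tendsto (scaledMean ρ φ) atTop (𝓝 L)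

theorem scaledMean_const_mul {ρ : Measure ℝ} {φ : ℝ → ℝ} (c y : ℝ) :
    scaledMean ρ (fun p => c * φ p) y = c * scaledMean ρ φ y := by
  simp only [scaledMean, mul_assoc]
  rw [integral_const_mul, mul_div_assoc]

theorem HasScaledMeanLimit.const_mul {ρ : Measure ℝ} {φ : ℝ → ℝ}
    (hφ : HasScaledMeanLimit ρ φ) (c : ℝ) :
    HasScaledMeanLimit ρ (fun p => c * φ p) := by
  obtain ⟨hφ, L, hL⟩ := hφ
  refine ⟨continuousOn_const.mul hφ, c * L, (hL.const_mul c).congr fun y => ?_⟩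
  rw [scaledMean_const_mul]

section
variable {ρ : Measure ℝ} [IsFiniteMeasure ρ] {φ ψ : ℝ → ℝ}

theorem sq_div_sq_add_sq_mem_Icc (t y : ℝ) : y ^ 2 / (t ^ 2 + y ^ 2) ∈ Set.Icc (0 : ℝ) 1 := by
  rw [add_comm]
  exact ⟨sq_div_sq_add_sq_nonneg y t, sq_div_sq_add_sq_le_one y t⟩

theorem integrable_comp_mul_sq_div_sq_add_sq (hφ : ContinuousOn φ (Set.Icc 0 1)) {y : ℝ}
    (hy : 0 < y) :
    Integrable (fun t => φ (y ^ 2 / (t ^ 2 + y ^ 2)) * (t ^ 2 / (t ^ 2 + y ^ 2))) ρ := by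
  obtain ⟨C, hC⟩ := isCompact_Icc.exists_bound_of_continuousOn hφ
  refine (integrable_sq_div_sq_add_sq ρ y).bdd_mul (c := C) ?_
    (ae_of_all _ fun t => hC _ (sq_div_sq_add_sq_mem_Icc t y))
  refine (hφ.comp_continuous ?_ fun t => sq_div_sq_add_sq_mem_Icc t y).aestronglyMeasurable
  exact Continuous.div (by fun_prop) (by fun_prop) fun t => by positivity

theorem scaledMean_add (hφ : ContinuousOn φ (Set.Icc 0 1)) (hψ : ContinuousOn ψ (Set.Icc 0 1))
    {y : ℝ} (hy : 0 < y) :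
    scaledMean ρ (fun p => φ p + ψ p) y = scaledMean ρ φ y + scaledMean ρ ψ y := by
  simp only [scaledMean, add_mul]
  rw [integral_add (integrable_comp_mul_sq_div_sq_add_sq hφ hy)
    (integrable_comp_mul_sq_div_sq_add_sq hψ hy), add_div]

theorem abs_scaledMean_le {ε y : ℝ} (hε : 0 ≤ ε)
    (h : ∀ p ∈ Set.Icc (0 : ℝ) 1, |φ p| ≤ ε) : |scaledMean ρ φ y| ≤ ε := by
  have hG : 0 ≤ ∫ t, t ^ 2 / (t ^ 2 + y ^ 2) ∂ρ :=
    integral_nonneg fun t => sq_div_sq_add_sq_nonneg t y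
  rw [scaledMean, abs_div, abs_of_nonneg hG]
  refine div_le_of_le_mul₀ hG hε ?_
  rw [← integral_const_mul]
  rw [← Real.norm_eq_abs]
  refine norm_integral_le_of_norm_le ((integrable_sq_div_sq_add_sq ρ y).const_mul ε)
    (ae_of_all _ fun t => ?_)
  rw [Real.norm_eq_abs, abs_mul, abs_of_nonneg (sq_div_sq_add_sq_nonneg t y)]
  exact mul_le_mul_of_nonneg_right (h _ (sq_div_sq_add_sq_mem_Icc t y))
    (sq_div_sq_add_sq_nonneg t y)

theorem HasScaledMeanLimit.add (hφ : HasScaledMeanLimit ρ φ) (hψ : HasScaledMeanLimit ρ ψ) :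
    HasScaledMeanLimit ρ (fun p => φ p + ψ p) := by
  obtain ⟨hφ, L, hL⟩ := hφ
  obtain ⟨hψ, M, hM⟩ := hψ
  refine ⟨hφ.add hψ, L + M, (hL.add hM).congr' ?_⟩
  filter_upwards [eventually_gt_atTop 0] with y hy
  rw [scaledMean_add hφ hψ hy]

theorem HasScaledMeanLimit.of_forall_approx (hφ : ContinuousOn φ (Set.Icc 0 1))
    (h : ∀ ε > 0, ∃ ψ, HasScaledMeanLimit ρ ψ ∧ ∀ p ∈ Set.Icc (0 : ℝ) 1, |φ p - ψ p| ≤ ε) :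
    HasScaledMeanLimit ρ φ := by
  refine ⟨hφ, exists_tendsto_of_forall_eventually_abs_sub_le fun ε hε => ?_⟩
  obtain ⟨ψ, ⟨hψ, L, hL⟩, hd⟩ := h (ε / 2) (by positivity)
  refine ⟨L, ?_⟩
  filter_upwards [hL.eventually (Metric.closedBall_mem_nhds L (half_pos hε)),
    eventually_gt_atTop 0] with y h1 hy
  rw [Real.dist_eq] at h1
  have h2 := abs_scaledMean_le (ρ := ρ) (y := y) (φ := φ - ψ) (half_pos hε).le hd
  have h3 := scaledMean_add (ρ := ρ) (hφ.sub hψ) hψ hy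
  simp only [Pi.sub_apply, sub_add_cancel] at h3
  have h4 : scaledMean ρ φ y - L
      = scaledMean ρ (φ - ψ) y + (scaledMean ρ ψ y - L) := by
    rw [← add_sub_assoc]
    exact congrArg (· - L) h3
  rw [h4]
  exact (abs_add_le _ _).trans (by linarith)

theorem one_sub_mul_pos {z p : ℝ} (hz0 : 0 < z) (hz1 : z < 1) (hp : p ∈ Set.Icc (0 : ℝ) 1) :
    0 < 1 - z * p := by
  nlinarith [hp.1, hp.2]

/-- As z → 0, p^n/(1-zp) → p^n uniformly on [0,1]. -/
theorem hasScaledMeanLimit_pow_of_geometric {n : ℕ}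
    (h : ∀ z : ℝ, 0 < z → z < 1 → HasScaledMeanLimit ρ (fun p => p ^ n / (1 - z * p))) :
    HasScaledMeanLimit ρ (fun p => p ^ n) := by
  refine HasScaledMeanLimit.of_forall_approx (by fun_prop) fun ε hε => ?_
  have hz0 : 0 < min (1 / 2) (ε / 2) := by positivity
  have hz1 : min (1 / 2) (ε / 2) ≤ 1 / 2 := min_le_left _ _
  have hz2 : min (1 / 2) (ε / 2) ≤ ε / 2 := min_le_right _ _
  set z := min (1 / 2) (ε / 2)
  refine ⟨_, h z hz0 (by linarith), fun p hp => ?_⟩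
  have hpos := one_sub_mul_pos hz0 (by linarith) hp
  have e : p ^ n - p ^ n / (1 - z * p) = -(p ^ n * (z * p) / (1 - z * p)) := by
    field_simp
    ring
  have hp0 := hp.1
  rw [e, abs_neg, abs_of_nonneg (by positivity), div_le_iff₀ hpos]
  have h1 : p ^ n ≤ 1 := pow_le_one₀ hp.1 hp.2
  have h2 : z * p ≤ z := by nlinarith [hp.2]
  calc p ^ n * (z * p) ≤ 1 * z := by gcongr
    _ ≤ ε * (1 - z * p) := by nlinarith

theorem hasScaledMeanLimit_geometric {α : ℝ}
    (hreg : ∀ s : ℝ, 0 < s → Tendsto (fun y => (∫ t, t ^ 2 / (t ^ 2 + (s * y) ^ 2) ∂ρ) /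
      ∫ t, t ^ 2 / (t ^ 2 + y ^ 2) ∂ρ) atTop (𝓝 (s ^ (-α)))) (n : ℕ) :
    ∀ z : ℝ, 0 < z → z < 1 → HasScaledMeanLimit ρ (fun p => p ^ n / (1 - z * p)) := by
  have hc (n : ℕ) (z : ℝ) (hz0 : 0 < z) (hz1 : z < 1) :
      ContinuousOn (fun p : ℝ => p ^ n / (1 - z * p)) (Set.Icc 0 1) :=
    ContinuousOn.div (by fun_prop) (by fun_prop) fun p hp => (one_sub_mul_pos hz0 hz1 hp).ne'
  induction n with
  | zero =>
    intro z hz0 hz1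
    -- Dividing t²/(t²+y²) by 1 - zp gives t²/(t²+(1-z)y²), the integrand at scale √(1-z)·y.
    refine ⟨hc 0 z hz0 hz1, _, (hreg (√(1 - z)) (Real.sqrt_pos.2 (by linarith))).congr' ?_⟩
    filter_upwards [eventually_gt_atTop 0] with y hy
    rw [scaledMean]
    congr 2 with t
    have h1 := one_sub_mul_pos hz0 hz1 (sq_div_sq_add_sq_mem_Icc t y)
    rw [mul_pow, Real.sq_sqrt (by linarith)]
    have h2 : 0 < t ^ 2 + (1 - z) * y ^ 2 := by
      have : 0 < 1 - z := by linarith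
      positivity
    rw [show 1 - z * (y ^ 2 / (t ^ 2 + y ^ 2)) = (t ^ 2 + (1 - z) * y ^ 2) / (t ^ 2 + y ^ 2) by
      field_simp; ring]
    field_simp
  | succ n ih =>
    intro z hz0 hz1
    refine HasScaledMeanLimit.of_forall_approx (hc _ z hz0 hz1) fun ε hε =>
      ⟨_, ((ih z hz0 hz1).add ((hasScaledMeanLimit_pow_of_geometric ih).const_mul (-1))).const_mul
        z⁻¹, fun p hp => ?_⟩
    have h1 := one_sub_mul_pos hz0 hz1 hp
    -- The approximation is exact: subtracting the leading term of the geometric series raises the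
    -- power by one.
    have : p ^ (n + 1) / (1 - z * p) - z⁻¹ * (p ^ n / (1 - z * p) + -1 * p ^ n) = 0 := by
      field_simp
      ring
    rw [this, abs_zero]
    exact hε.le

theorem hasScaledMeanLimit_of_continuousOn {α : ℝ}
    (hreg : ∀ s : ℝ, 0 < s → Tendsto (fun y => (∫ t, t ^ 2 / (t ^ 2 + (s * y) ^ 2) ∂ρ) /
      ∫ t, t ^ 2 / (t ^ 2 + y ^ 2) ∂ρ) atTop (𝓝 (s ^ (-α))))
    (hφ : ContinuousOn φ (Set.Icc 0 1)) : HasScaledMeanLimit ρ φ := by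
  have hpoly (P : Polynomial ℝ) : HasScaledMeanLimit ρ (fun p => P.eval p) := by
    induction P using Polynomial.induction_on' with
    | add P Q hP hQ => simpa using hP.add hQ
    | monomial n c =>
      simpa using
        (hasScaledMeanLimit_pow_of_geometric (hasScaledMeanLimit_geometric hreg n)).const_mul c
  refine HasScaledMeanLimit.of_forall_approx hφ fun ε hε => ?_
  obtain ⟨P, hP⟩ := exists_polynomial_near_of_continuousOn 0 1 φ hφ ε hε
  refine ⟨_, hpoly P, fun p hp => ?_⟩
  rw [abs_sub_comm]
  exact (hP p hp).le

theorem exists_tendsto_between_measureReal_Ioi (hρ : ∀ᵐ t ∂ρ, 0 ≤ t) {α : ℝ}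
    (hreg : ∀ s : ℝ, 0 < s → Tendsto (fun y => (∫ t, t ^ 2 / (t ^ 2 + (s * y) ^ 2) ∂ρ) /
      ∫ t, t ^ 2 / (t ^ 2 + y ^ 2) ∂ρ) atTop (𝓝 (s ^ (-α)))) {q : ℝ} (hq : 1 < q) :
    ∃ (S : ℝ → ℝ) (L : ℝ),
      (∀ y, 0 < y → ρ.real (Set.Ioi (q * y)) ≤ S y ∧ S y ≤ ρ.real (Set.Ioi y)) ∧
      Tendsto (fun y => S y / ∫ t, t ^ 2 / (t ^ 2 + y ^ 2) ∂ρ) atTop (𝓝 L) := by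
  have hb : 0 < 1 / 2 - 1 / (1 + q ^ 2) := by
    rw [sub_pos]
    exact one_div_lt_one_div_of_lt two_pos (by nlinarith)
  -- For t ≥ 0, p = 1/2 corresponds to t = y and p = 1/(1+q²) to t = qy.
  set r : ℝ → ℝ := fun p => max 0 (min 1 ((1 / 2 - p) / (1 / 2 - 1 / (1 + q ^ 2)))) with hr
  have hr0 (p : ℝ) : 0 ≤ r p := le_max_left _ _
  have hr1 (p : ℝ) : r p ≤ 1 := max_le zero_le_one (min_le_left _ _)
  have hr_one (p : ℝ) (hp : p ≤ 1 / (1 + q ^ 2)) : r p = 1 := by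
    have : 1 ≤ (1 / 2 - p) / (1 / 2 - 1 / (1 + q ^ 2)) := by
      rw [one_le_div hb]
      linarith
    simp only [hr]
    rw [min_eq_left this, max_eq_right zero_le_one]
  have hr_zero (p : ℝ) (hp : 1 / 2 ≤ p) : r p = 0 :=
    max_eq_left ((min_le_right _ _).trans (div_nonpos_of_nonpos_of_nonneg (by linarith) hb.le))
  -- Dividing by 1 - p cancels the weight t²/(t²+y²); the maximum only acts where r vanishes.
  have hφ : Continuous fun p => r p / max (1 - p) (1 / 2) :=
    Continuous.div (by fun_prop) (by fun_prop)
      fun p => (lt_max_of_lt_right one_half_pos).ne'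
  obtain ⟨-, L, hL⟩ := hasScaledMeanLimit_of_continuousOn hreg hφ.continuousOn
  have hmul (y : ℝ) (hy : 0 < y) (t : ℝ) :
      r (y ^ 2 / (t ^ 2 + y ^ 2)) / max (1 - y ^ 2 / (t ^ 2 + y ^ 2)) (1 / 2) *
        (t ^ 2 / (t ^ 2 + y ^ 2)) = r (y ^ 2 / (t ^ 2 + y ^ 2)) := by
    have hw : t ^ 2 / (t ^ 2 + y ^ 2) = 1 - y ^ 2 / (t ^ 2 + y ^ 2) := by
      field_simp
      ring
    rw [hw]
    rcases le_total (1 / 2) (y ^ 2 / (t ^ 2 + y ^ 2)) with h | h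
    · simp [hr_zero _ h]
    · rw [max_eq_left (by linarith), div_mul_cancel₀]
      linarith
  have hint (y : ℝ) (hy : 0 < y) : Integrable (fun t => r (y ^ 2 / (t ^ 2 + y ^ 2))) ρ :=
    (integrable_comp_mul_sq_div_sq_add_sq hφ.continuousOn hy).congr (ae_of_all _ (hmul y hy))
  refine ⟨fun y => ∫ t, r (y ^ 2 / (t ^ 2 + y ^ 2)) ∂ρ, L, fun y hy => ⟨?_, ?_⟩, hL.congr' ?_⟩
  · rw [← integral_indicator_one measurableSet_Ioi]
    refine integral_mono ((integrable_const 1).indicator measurableSet_Ioi) (hint y hy) fun t => ?_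
    refine Set.indicator_apply_le' (fun ht => ?_) (fun _ => hr0 _)
    have ht : q * y < t := ht
    rw [hr_one, Pi.one_apply]
    rw [div_le_div_iff₀ (by positivity) (by positivity)]
    have : (q * y) ^ 2 ≤ t ^ 2 := by gcongr
    nlinarith
  · rw [← integral_indicator_one measurableSet_Ioi]
    refine integral_mono_ae (hint y hy) ((integrable_const 1).indicator measurableSet_Ioi) ?_
    filter_upwards [hρ] with t ht
    by_cases h : t ∈ Set.Ioi y
    · rw [Set.indicator_of_mem h]
      exact hr1 _
    · rw [Set.indicator_of_notMem h]
      have h : t ≤ y := not_lt.1 h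
      refine (hr_zero _ ?_).le
      rw [div_le_div_iff₀ (by norm_num) (by positivity)]
      have : t ^ 2 ≤ y ^ 2 := by gcongr
      linarith
  · filter_upwards [eventually_gt_atTop 0] with y hy
    rw [scaledMean]
    simp_rw [hmul y hy]

theorem exists_tendsto_measureReal_Ioi_div (hρ : ∀ᵐ t ∂ρ, 0 ≤ t) {α : ℝ}
    (hreg : ∀ s : ℝ, 0 < s → Tendsto (fun y => (∫ t, t ^ 2 / (t ^ 2 + (s * y) ^ 2) ∂ρ) /
      ∫ t, t ^ 2 / (t ^ 2 + y ^ 2) ∂ρ) atTop (𝓝 (s ^ (-α)))) :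
    ∃ l, Tendsto (fun y => ρ.real (Set.Ioi y) / ∫ t, t ^ 2 / (t ^ 2 + y ^ 2) ∂ρ) atTop
      (𝓝 l) := by
  set G : ℝ → ℝ := fun y => ∫ t, t ^ 2 / (t ^ 2 + y ^ 2) ∂ρ with hG
  have hGpos : ∀ᶠ y in atTop, 0 < G y := eventually_pos_of_tendsto_self_div
    (fun y => integral_nonneg fun t => sq_div_sq_add_sq_nonneg t y) hreg
  refine exists_tendsto_of_forall_eventually_abs_sub_le fun ε hε => ?_
  -- With L ≤ 2, the gap L·q^α - L between the limiting bounds is at most ε/2.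
  obtain ⟨q, hqε, hq⟩ : ∃ q : ℝ, q ^ α < 1 + ε / 4 ∧ 1 < q := by
    have h : Tendsto (fun q : ℝ => q ^ α) (𝓝[>] 1) (𝓝 1) := by
      have := (Real.continuousAt_rpow_const 1 α (Or.inl one_ne_zero)).tendsto
      rw [Real.one_rpow] at this
      exact this.mono_left nhdsWithin_le_nhds
    exact ((h.eventually_lt_const (by linarith)).and self_mem_nhdsWithin).exists
  have hq0 : 0 < q := by linarith
  obtain ⟨S, L, hS, hL⟩ := exists_tendsto_between_measureReal_Ioi hρ hreg hq
  change Tendsto (fun y => S y / G y) atTop (𝓝 L) at hL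
  have hm : Tendsto (fun y : ℝ => q⁻¹ * y) atTop atTop :=
    tendsto_id.const_mul_atTop (inv_pos.2 hq0)
  have hL0 : 0 ≤ L := by
    refine ge_of_tendsto hL ?_
    filter_upwards [hGpos, eventually_gt_atTop 0] with y hy hy0
    exact div_nonneg (measureReal_nonneg.trans (hS y hy0).1) hy.le
  have hL2 : L ≤ 2 := by
    refine le_of_tendsto hL ?_
    filter_upwards [hGpos, eventually_gt_atTop 0] with y hy hy0
    rw [div_le_iff₀ hy]
    exact (hS y hy0).2.trans (measureReal_Ioi_le_two_mul_integral ρ hy0)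
  have hU : Tendsto (fun y => S (q⁻¹ * y) / G y) atTop (𝓝 (L * q ^ α)) := by
    have h := (hL.comp hm).mul (hreg q⁻¹ (inv_pos.2 hq0))
    rw [Real.inv_rpow hq0.le, Real.rpow_neg hq0.le, inv_inv] at h
    refine h.congr' ?_
    filter_upwards [hm.eventually hGpos] with y hy
    change S (q⁻¹ * y) / G (q⁻¹ * y) * (G (q⁻¹ * y) / G y) = _
    rw [div_mul_div_cancel₀ hy.ne']
  refine ⟨L, ?_⟩
  filter_upwards [hGpos, eventually_gt_atTop 0,
    hL.eventually_const_lt (show L - ε < L by linarith),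
    hU.eventually_lt_const (show L * q ^ α < L * q ^ α + ε / 2 by linarith)] with y hy hy0 h1 h2
  have hlow : S y / G y ≤ ρ.real (Set.Ioi y) / G y := by
    gcongr
    exact (hS y hy0).2
  have hup : ρ.real (Set.Ioi y) / G y ≤ S (q⁻¹ * y) / G y := by
    gcongr
    have := (hS (q⁻¹ * y) (by positivity)).1
    rwa [mul_inv_cancel_left₀ hq0.ne'] at this
  rw [abs_le]
  constructor
  · linarith
  · nlinarith

end

/-! ### The two limits and the equivalence -/

theorem tendsto_integral_div_measureReal_Ioi {ρ : Measure ℝ} [IsFiniteMeasure ρ]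
    (hρ : ∀ᵐ t ∂ρ, 0 ≤ t) {α : ℝ} (h0 : 0 ≤ α) (h2 : α < 2)
    (hreg : ∀ s : ℝ, 0 < s →
      Tendsto (fun y => ρ.real (Set.Ioi (s * y)) / ρ.real (Set.Ioi y)) atTop (𝓝 (s ^ (-α)))) :
    Tendsto (fun y => (∫ t, t ^ 2 / (t ^ 2 + y ^ 2) ∂ρ) / ρ.real (Set.Ioi y)) atTop
      (𝓝 (stieltjesConst α)) := by
  have hnn (y : ℝ) : 0 ≤ ρ.real (Set.Ioi y) := measureReal_nonneg
  have hpos := eventually_pos_of_tendsto_self_div hnn hreg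
  have h := tendsto_integral_stieltjesKernel_mul_div (l := 1) (C₀ := 1) h0 h2
    (antitone_measureReal_Ioi ρ).measurable hnn (fun x _ => (one_mul _).ge)
    ((antitone_measureReal_Ioi ρ).antitoneOn _) hnn hpos hreg
    (tendsto_const_nhds.congr' (hpos.mono fun x hx => (div_self hx.ne').symm))
  rw [one_mul] at h
  refine h.congr' ?_
  filter_upwards [eventually_gt_atTop 0] with y hy
  rw [integral_sq_div_sq_add_sq_eq_integral_measureReal_Ioi hρ hy]

theorem tendsto_measureReal_Ioi_div_integral {ρ : Measure ℝ} [IsFiniteMeasure ρ]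
    (hρ : ∀ᵐ t ∂ρ, 0 ≤ t) {α : ℝ} (h0 : 0 ≤ α) (h2 : α < 2)
    (hreg : ∀ s : ℝ, 0 < s → Tendsto (fun y => (∫ t, t ^ 2 / (t ^ 2 + (s * y) ^ 2) ∂ρ) /
      ∫ t, t ^ 2 / (t ^ 2 + y ^ 2) ∂ρ) atTop (𝓝 (s ^ (-α)))) :
    Tendsto (fun y => ρ.real (Set.Ioi y) / ∫ t, t ^ 2 / (t ^ 2 + y ^ 2) ∂ρ) atTop
      (𝓝 (stieltjesConst α)⁻¹) := by
  have hnn (y : ℝ) : 0 ≤ ∫ t, t ^ 2 / (t ^ 2 + y ^ 2) ∂ρ :=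
    integral_nonneg fun t => sq_div_sq_add_sq_nonneg t y
  have hpos := eventually_pos_of_tendsto_self_div hnn hreg
  obtain ⟨l, hl⟩ := exists_tendsto_measureReal_Ioi_div hρ hreg
  have h := tendsto_integral_stieltjesKernel_mul_div h0 h2
    (antitone_measureReal_Ioi ρ).measurable (fun _ => measureReal_nonneg)
    (fun y hy => measureReal_Ioi_le_two_mul_integral ρ hy)
    (antitoneOn_integral_sq_div_sq_add_sq ρ) hnn hpos hreg hl
  -- The numerator in `h` is the transform itself, so the quotient is eventually 1; this fixes l.
  have h1 : l * stieltjesConst α = 1 := by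
    refine tendsto_nhds_unique h (tendsto_const_nhds.congr' ?_)
    filter_upwards [hpos, eventually_gt_atTop 0] with y hy hy0
    rw [← integral_sq_div_sq_add_sq_eq_integral_measureReal_Ioi hρ hy0, div_self hy.ne']
  rwa [← eq_inv_of_mul_eq_one_left h1]

theorem mainTheorem10 (ρ : Measure ℝ) [IsFiniteMeasure ρ] (hρ : ρ (Set.Iio 0) = 0)
    (α : ℝ) (hα0 : 0 ≤ α) (hα2 : α < 2) :
    (IsRegularlyVarying (fun y : ℝ => ρ.real (Set.Ioi y)) (-α) ↔
      IsRegularlyVarying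
        (fun y : ℝ => ∫ t in Set.Ici (0 : ℝ), t ^ 2 / (t ^ 2 + y ^ 2) ∂ρ) (-α)) ∧
    ((IsRegularlyVarying (fun y : ℝ => ρ.real (Set.Ioi y)) (-α) ∨
      IsRegularlyVarying
        (fun y : ℝ => ∫ t in Set.Ici (0 : ℝ), t ^ 2 / (t ^ 2 + y ^ 2) ∂ρ) (-α)) →
      (fun y : ℝ => ∫ t in Set.Ici (0 : ℝ), t ^ 2 / (t ^ 2 + y ^ 2) ∂ρ) ~[atTop]
        (fun y : ℝ => stieltjesConst α * ρ.real (Set.Ioi y))) := by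
  have hae : ∀ᵐ t ∂ρ, 0 ≤ t := by
    rw [ae_iff]
    simp only [not_le]
    exact hρ
  rw [Measure.restrict_eq_self_of_ae_mem (s := Set.Ici 0) hae]
  have hc := stieltjesConst_pos hα0 hα2
  have hFm : Measurable fun x : Set.Ici (0 : ℝ) => ρ.real (Set.Ioi (x : ℝ)) :=
    (antitone_measureReal_Ioi ρ).measurable.comp measurable_subtype_coe
  have hGm : Measurable fun x : Set.Ici (0 : ℝ) => ∫ t, t ^ 2 / (t ^ 2 + (x : ℝ) ^ 2) ∂ρ :=
    Antitone.measurable fun x y hxy => antitoneOn_integral_sq_div_sq_add_sq ρ x.2 y.2 hxy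
  have abel : IsRegularlyVarying (fun y : ℝ => ρ.real (Set.Ioi y)) (-α) →
      IsRegularlyVarying (fun y : ℝ => ∫ t, t ^ 2 / (t ^ 2 + y ^ 2) ∂ρ) (-α) := fun h =>
    ⟨hGm, tendsto_div_rpow_of_tendsto_div hc.ne'
      (eventually_pos_of_tendsto_self_div (fun _ => measureReal_nonneg) h.2) h.2
      (tendsto_integral_div_measureReal_Ioi hae hα0 hα2 h.2)⟩
  have tauber : IsRegularlyVarying (fun y : ℝ => ∫ t, t ^ 2 / (t ^ 2 + y ^ 2) ∂ρ) (-α) →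
      IsRegularlyVarying (fun y : ℝ => ρ.real (Set.Ioi y)) (-α) := fun h =>
    ⟨hFm, tendsto_div_rpow_of_tendsto_div (inv_ne_zero hc.ne')
      (eventually_pos_of_tendsto_self_div
        (fun y => integral_nonneg fun t => sq_div_sq_add_sq_nonneg t y) h.2) h.2
      (tendsto_measureReal_Ioi_div_integral hae hα0 hα2 h.2)⟩
  refine ⟨⟨abel, tauber⟩, fun h => ?_⟩
  have hF := (h.elim id tauber).2
  refine isEquivalent_of_tendsto_one ?_
  have := (tendsto_integral_div_measureReal_Ioi hae hα0 hα2 hF).div_const (stieltjesConst α)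
  rw [div_self hc.ne'] at this
  refine this.congr fun y => ?_
  simp only [Pi.div_apply]
  rw [div_div, mul_comm]
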